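/- Notation. $(a)_k=a(a+1)\cdots(a+k-1)$ is the Pochhammer symbol, ${}_2F_1(\alpha,\beta;\gamma;z)$ is the Gauss hypergeometric function, i.e. the sum of $\sum_{k\ge0}\frac{(\alpha)_k(\beta)_k}{(\gamma)_k\,k!}z^k$ for $|z|<1$ and its analytic continuation to $z\in\mathbb C\setminus[1,\infty)$; if $\alpha=-i$ with $i\in\{0,1,2,\dots\}$ it is the terminating sum, for all $z\in\mathbb C$. Olsson's function $F_P$ is defined by $$F_P(a,b_1,b_2,c_1,c_2;x,y)=\sum_{i,j=0}^\infty\frac{(a)_{i+j}(a-c_2+1)_i(b_1)_i(b_2)_j}{(a+b_2-c_2+1)_{i+j}(c_1)_i\,i!\,j!}\,x^i(1-y)^j\qquad(|x|<1,\ |y-1|<1)$$ and by analytic continuation to $\{(x,y)\in\mathbb C^2: x\notin[1,\infty),\ y\notin(-\infty,0]\}$. Statement. Let $a,b_1,b_2,c_1,c_2\in\mathbb C$ with $$\operatorname{Re}a,\ \operatorname{Re}(a-b_2),\ \operatorname{Re}(b_2+c_1-a),\ \operatorname{Re}(b_2-c_2+1),\ \operatorname{Re}(c_1+c_2-a-1)>0.$$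 Then the analytic continuations of $F_P(a,b_1,b_2,c_1,c_2;\cdot,\cdot)$ and of ${}_2F_1(a,b_1;b_2+c_1+i;\cdot)$ ($i=0,1,2,\dots$) to the regions above exist, and for all $(x,y)\in\mathbb C^2$ with $x\notin[1,\infty)$, $y\notin(-\infty,0]$ and $\operatorname{Re}y>\tfrac12$, $$F_P(a,b_1,b_2,c_1,c_2;x,y)=\frac{\Gamma(c_1)\Gamma(a+b_2-c_2+1)}{\Gamma(a-c_2+1)\Gamma(b_2+c_1)}\,y^{-b_2}\sum_{i=0}^\infty\frac{(b_2)_i(b_2+c_1-a)_i}{(b_2+c_1)_i\,i!}\;{}_2F_1(a,b_1;b_2+c_1+i;x)\;{}_2F_1(-i,b_2-c_2+1;b_2+c_1-a;y^{-1}),$$ where the series converges absolutely and $y^{-b_2}$ has its principal value. -/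

import Mathlib

noncomputable section

/-- `F` is a holomorphic continuation to `U` of the function `f` given on `V`: it is holomorphic
(complex Fréchet differentiable, jointly in all variables) on `U` and agrees with `f` on `V`.
It is used for `V ⊆ U` open and nonempty and `U` open and connected, where two such functions
agree on `U`. -/
def IsHolomorphicContinuation {E : Type*} [NormedAddCommGroup E] [NormedSpace ℂ E]
    (f : E → ℂ) (V U : Set E) (F : E → ℂ) : Prop :=
  DifferentiableOn ℂ F U ∧ Set.EqOn F f V

open Classical in
/-- The holomorphic continuation to `U` of the function `f` given on `V`
(the zero function if there is none). -/
def holomorphicContinuation {E : Type*} [NormedAddCommGroup E] [NormedSpace ℂ E]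
    (f : E → ℂ) (V U : Set E) : E → ℂ :=
  if h : ∃ F : E → ℂ, IsHolomorphicContinuation f V U F then Classical.choose h else 0

/-- The Pochhammer symbol `(a)_n = a (a + 1) ⋯ (a + n - 1)`. -/
def poch (a : ℂ) (n : ℕ) : ℂ := (ascPochhammer ℂ n).eval a

/-- The cut plane `ℂ \ [1, ∞)`. -/
def gaussDomain : Set ℂ := {x | x ∉ Complex.ofReal '' Set.Ici 1}

/-- The Gauss hypergeometric function on `ℂ \ [1, ∞)`: the analytic continuation of the
power series `∑ (a)_k (b)_k / ((c)_k k!) z ^ k`, `|z| < 1` (Mathlib's `ordinaryHypergeometric`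
is the sum of that series). -/
def gaussF (a b c : ℂ) : ℂ → ℂ :=
  holomorphicContinuation (ordinaryHypergeometric a b c : ℂ → ℂ) (Metric.ball 0 1) gaussDomain

/-- The region `|x| < 1`, `|y - 1| < 1` of `ℂ²`. -/
def olssonPolydisc : Set (ℂ × ℂ) := {p | ‖p.1‖ < 1 ∧ ‖p.2 - 1‖ < 1}

/-- The region `x ∉ [1, ∞)`, `y ∉ (-∞, 0]` of `ℂ²`. -/
def olssonDomain : Set (ℂ × ℂ) :=
  {p | p.1 ∉ Complex.ofReal '' Set.Ici 1 ∧ p.2 ∉ Complex.ofReal '' Set.Iic 0}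

/-- The double power series of Olsson's function `F_P` around the point `(0, 1)`. -/
def olssonSeries (a b₁ b₂ c₁ c₂ : ℂ) (p : ℂ × ℂ) : ℂ :=
  ∑' n : ℕ × ℕ,
    (poch a (n.1 + n.2) * poch (a - c₂ + 1) n.1 * poch b₁ n.1 * poch b₂ n.2) /
      (poch (a + b₂ - c₂ + 1) (n.1 + n.2) * poch c₁ n.1 * (n.1.factorial : ℂ)
        * (n.2.factorial : ℂ)) * p.1 ^ n.1 * (1 - p.2) ^ n.2

/-- Olsson's function `F_P` as a function on the region `x ∉ [1, ∞)`, `y ∉ (-∞, 0]`: the analytic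
continuation of its double power series on `|x| < 1`, `|y - 1| < 1`. -/
def olssonFP (a b₁ b₂ c₁ c₂ : ℂ) : ℂ × ℂ → ℂ :=
  holomorphicContinuation (olssonSeries a b₁ b₂ c₁ c₂) olssonPolydisc olssonDomain

/-- The `i`-th term of the expansion. Here `₂F₁(-i, b₂ - c₂ + 1; b₂ + c₁ - a; 1 / y)` is a
terminating series (a polynomial in `1 / y`), so Mathlib's series applies for every `y ≠ 0`. -/
def almstromOlssonTerm (a b₁ b₂ c₁ c₂ x y : ℂ) (i : ℕ) : ℂ :=
  (poch b₂ i * poch (b₂ + c₁ - a) i) / (poch (b₂ + c₁) i * (i.factorial : ℂ)) *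
    gaussF a b₁ (b₂ + c₁ + i) x *
    ordinaryHypergeometric (-(i : ℂ)) (b₂ - c₂ + 1) (b₂ + c₁ - a) (1 / y)

end

/-! Write β = b₂ - c₂ + 1, p = a - c₂ + 1, δ = c₁ + c₂ - a - 1, γ = b₂ + c₁ - a, so that β + δ = γ
and p + δ = c₁. Up to beta constants, F_P is the Euler integral over the unit square of (1 -
xuv)^(-b₁) (1 - v(1 - y))^(-b₂) against beta weights with exponents (p, δ) in u and (a, β) in v:
expand both factors and integrate termwise. The kernel is regular on the whole cut domain, so the
integral gives the continuation (`isHolomorphicContinuation_olssonIntegral`).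

Put t = uv and then u = t + (1 - t)s. The integral becomes one over (t, s) with beta weights (a, γ)
and (β, δ) and kernel (1 - xt)^(-b₁) (ty + (1 - t)s)^(-b₂) (`integral_eq_olssonIntegral`). Since ty
+ (1 - t)s = y(1 - (1 - t)(1 - s/y)), and |1 - s/y| ≤ 1 when Re y > 1/2, the last factor has a
binomial expansion whose terms separate t from s. The t-integral is Euler's integral for ₂F₁(a, b₁;
b₂ + c₁ + i; x), the s-integral the one for the terminating ₂F₁ (`hasSum_integral_binomial`,
`almstromOlssonTerm_eq`).

The interchange is dominated by comparing (b₂)_i with (r)_i for a real r between max(Re b₂, 0) and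
Re a. -/

namespace Olsson
open MeasureTheory Set Filter Topology Complex

/-! ### Beta integrals, Pochhammer symbols, binomial series -/

/-- Lebesgue measure on the unit interval. -/
noncomputable abbrev unitMeasure : Measure ℝ := volume.restrict (Ioo (0 : ℝ) 1)

/-- The density of the (complex) beta integral. -/
noncomputable def betaW (p q : ℂ) (s : ℝ) : ℂ := (s : ℂ) ^ (p - 1) * (1 - (s : ℂ)) ^ (q - 1)

lemma unitMeasure_ae_mem : ∀ᵐ s ∂unitMeasure, s ∈ Ioo (0 : ℝ) 1 :=
  ae_restrict_mem measurableSet_Ioo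

lemma unitMeasure_prod_ae_mem :
    ∀ᵐ z ∂(unitMeasure.prod unitMeasure), z ∈ Ioo (0 : ℝ) 1 ×ˢ Ioo (0 : ℝ) 1 := by
  rw [Measure.prod_restrict]
  exact ae_restrict_mem (measurableSet_Ioo.prod measurableSet_Ioo)

lemma integrable_betaW {p q : ℂ} (hp : 0 < p.re) (hq : 0 < q.re) :
    Integrable (betaW p q) unitMeasure := by
  have h := betaIntegral_convergent hp hq
  rw [intervalIntegrable_iff_integrableOn_Ioo_of_le zero_le_one] at h
  exact h

lemma integral_betaW (p q : ℂ) : ∫ s, betaW p q s ∂unitMeasure = betaIntegral p q := by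
  rw [betaIntegral, intervalIntegral.integral_of_le zero_le_one, integral_Ioc_eq_integral_Ioo]
  rfl

lemma betaW_mul_pow (p q : ℂ) {s : ℝ} (hs : s ∈ Ioo (0 : ℝ) 1) (k : ℕ) :
    betaW p q s * (s : ℂ) ^ k = betaW (p + k) q s := by
  have h0 : (s : ℂ) ≠ 0 := by exact_mod_cast hs.1.ne'
  rw [betaW, betaW, show p + k - 1 = (p - 1) + k by ring, cpow_add _ _ h0, cpow_natCast]
  ring

lemma betaW_mul_one_sub_pow (p q : ℂ) {s : ℝ} (hs : s ∈ Ioo (0 : ℝ) 1) (k : ℕ) :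
    betaW p q s * (1 - (s : ℂ)) ^ k = betaW p (q + k) s := by
  have h0 : 1 - (s : ℂ) ≠ 0 := by exact_mod_cast (sub_pos.2 hs.2).ne'
  rw [betaW, betaW, show q + k - 1 = (q - 1) + k by ring, cpow_add _ _ h0, cpow_natCast]
  ring

lemma poch_zero (a : ℂ) : poch a 0 = 1 := by simp [poch]

lemma poch_succ (a : ℂ) (n : ℕ) : poch a (n + 1) = poch a n * (a + n) := by
  simp [poch, ascPochhammer_succ_eval]

lemma add_natCast_ne_zero {a : ℂ} (ha : 0 < a.re) (n : ℕ) : a + n ≠ 0 := by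
  intro h
  have := congrArg re h
  simp at this
  have : (0 : ℝ) ≤ n := n.cast_nonneg
  linarith

lemma poch_ne_zero {a : ℂ} (ha : 0 < a.re) (n : ℕ) : poch a n ≠ 0 := by
  induction n with
  | zero => simp [poch_zero]
  | succ n ih => rw [poch_succ]; exact mul_ne_zero ih (add_natCast_ne_zero ha n)

lemma Gamma_add_natCast {a : ℂ} (ha : 0 < a.re) (n : ℕ) :
    Gamma (a + n) = poch a n * Gamma a := by
  induction n with
  | zero => simp [poch_zero]
  | succ n ih =>
    rw [poch_succ, Nat.cast_succ, ← add_assoc, Gamma_add_one _ (add_natCast_ne_zero ha n), ih]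
    ring

lemma betaIntegral_ne_zero {p q : ℂ} (hp : 0 < p.re) (hq : 0 < q.re) : betaIntegral p q ≠ 0 := by
  rw [betaIntegral_eq_Gamma_mul_div p q hp hq]
  exact div_ne_zero (mul_ne_zero (Gamma_ne_zero_of_re_pos hp) (Gamma_ne_zero_of_re_pos hq))
    (Gamma_ne_zero_of_re_pos (by simpa using add_pos hp hq))

lemma betaIntegral_add_natCast {p q : ℂ} (hp : 0 < p.re) (hq : 0 < q.re) (k : ℕ) :
    betaIntegral (p + k) q = poch p k / poch (p + q) k * betaIntegral p q := by
  have hpk : 0 < (p + k).re := by simp; positivity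
  have hpq : 0 < (p + q).re := by simpa using add_pos hp hq
  rw [betaIntegral_eq_Gamma_mul_div _ q hpk hq, betaIntegral_eq_Gamma_mul_div p q hp hq,
    show p + k + q = p + q + k by ring, Gamma_add_natCast hp, Gamma_add_natCast hpq]
  have := poch_ne_zero hpq k
  have := Gamma_ne_zero_of_re_pos hpq
  field_simp

lemma integral_betaW_mul_pow {p q : ℂ} (hp : 0 < p.re) (hq : 0 < q.re) (k : ℕ) :
    ∫ s, betaW p q s * (s : ℂ) ^ k ∂unitMeasure =
      poch p k / poch (p + q) k * betaIntegral p q := by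
  rw [← betaIntegral_add_natCast hp hq, ← integral_betaW]
  exact integral_congr_ae (unitMeasure_ae_mem.mono fun s hs => betaW_mul_pow p q hs k)

/-- Termwise integration of an absolutely summable combination of bounded functions against an
integrable weight. -/
lemma hasSum_integral_weight {α ι : Type*} [Countable ι] [MeasurableSpace α] {μ : Measure α}
    {w : α → ℂ} (hw : Integrable w μ) {c : ι → ℂ} (hc : Summable fun i => ‖c i‖)
    {m : ι → α → ℂ} (hm : ∀ i, AEStronglyMeasurable (m i) μ) (hm1 : ∀ i, ∀ᵐ s ∂μ, ‖m i s‖ ≤ 1)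
    {f : α → ℂ} (hf : ∀ᵐ s ∂μ, HasSum (fun i => c i * m i s) (f s)) :
    HasSum (fun i => c i * ∫ s, w s * m i s ∂μ) (∫ s, w s * f s ∂μ) := by
  simp_rw [← integral_const_mul]
  refine hasSum_integral_of_dominated_convergence (fun i s => ‖c i‖ * ‖w s‖)
    (fun i => (hw.aestronglyMeasurable.mul (hm i)).const_mul _) ?_ ?_ ?_ ?_
  · intro i
    filter_upwards [hm1 i] with s hs
    rw [norm_mul, norm_mul]
    gcongr
    exact mul_le_of_le_one_right (norm_nonneg _) hs
  · exact ae_of_all _ fun s => hc.mul_right _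
  · simp_rw [tsum_mul_right]
    exact hw.norm.const_mul _
  · filter_upwards [hf] with s hs
    simpa only [mul_left_comm (w s)] using hs.mul_left (w s)

lemma multichoose_eq_poch_div (b : ℂ) (n : ℕ) :
    Ring.multichoose b n = poch b n / n.factorial := by
  rw [eq_div_iff (by exact_mod_cast n.factorial_ne_zero), poch,
    ← Polynomial.ascPochhammer_smeval_eq_eval,
    ← Ring.factorial_nsmul_multichoose_eq_ascPochhammer b n, nsmul_eq_mul, mul_comm]

lemma hasSum_binomial (b : ℂ) {z : ℂ} (hz : ‖z‖ < 1) :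
    HasSum (fun n : ℕ => poch b n / n.factorial * z ^ n) ((1 - z) ^ (-b)) := by
  have h := (one_div_one_sub_cpow_hasFPowerSeriesOnBall_zero b).hasSum (y := z)
    (by simpa [enorm_eq_nnnorm, ← NNReal.coe_lt_coe] using hz)
  simp only [FormalMultilinearSeries.ofScalars_apply_eq, zero_add, ← Ring.multichoose_eq,
    multichoose_eq_poch_div,
    smul_eq_mul] at h
  simpa [cpow_neg] using h

lemma summable_norm_binomial (b : ℂ) {z : ℂ} (hz : ‖z‖ < 1) :
    Summable fun n : ℕ => ‖poch b n / n.factorial * z ^ n‖ :=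
  (hasSum_binomial b hz).summable.norm

lemma poch_neg_natCast (i n : ℕ) :
    poch (-(i : ℂ)) n / n.factorial = (-1) ^ n * (i.choose n : ℂ) := by
  have h := Ring.choose_neg' (-(i : ℂ)) n
  rw [neg_neg, Ring.choose_natCast, multichoose_eq_poch_div] at h
  rw [h, Int.negOnePow_def, Units.smul_def]
  have h2 : ((-1 : ℂ) ^ n) * (-1) ^ n = 1 := by rw [← mul_pow]; simp
  simp [← mul_assoc, h2]

/-- The coefficients vanish for n > i, so this is the finite binomial theorem and no bound on z is
needed. -/
lemma hasSum_binomial_neg_natCast (i : ℕ) (z : ℂ) :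
    HasSum (fun n : ℕ => poch (-(i : ℂ)) n / n.factorial * z ^ n) ((1 - z) ^ i) := by
  have h : (1 - z) ^ i = ∑ n ∈ Finset.range (i + 1),
      poch (-(i : ℂ)) n / n.factorial * z ^ n := by
    rw [sub_eq_neg_add, add_pow]
    refine Finset.sum_congr rfl fun n _ => ?_
    rw [poch_neg_natCast, neg_pow]
    simp; ring
  rw [h]
  clear h
  apply hasSum_sum_of_ne_finset_zero
  intro n hn
  have hn' : i < n := by
    rw [Finset.mem_range] at hn
    omega
  rw [poch_neg_natCast, Nat.choose_eq_zero_of_lt hn']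
  simp only [Nat.cast_zero, mul_zero, zero_mul]

lemma ordinaryHypergeometric_eq_tsum_poch (a b c x : ℂ) :
    (ordinaryHypergeometric a b c : ℂ → ℂ) x =
      ∑' n : ℕ, poch b n / n.factorial * x ^ n * (poch a n / poch c n) := by
  rw [ordinaryHypergeometric_eq_tsum]
  refine tsum_congr fun n => ?_
  simp only [poch, smul_eq_mul]
  ring

/-- Euler's integral for a hypergeometric series, from the generating function of the
coefficients `(b)ₙ / n! xⁿ`. -/
lemma ordinaryHypergeometric_eq_integral {a b δ x : ℂ} (ha : 0 < a.re) (hδ : 0 < δ.re)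
    (hc : Summable fun n : ℕ => ‖poch b n / n.factorial * x ^ n‖) {f : ℝ → ℂ}
    (hf : ∀ s ∈ Ioo (0 : ℝ) 1, HasSum (fun n : ℕ => poch b n / n.factorial * (x * s) ^ n) (f s)) :
    (ordinaryHypergeometric a b (a + δ) : ℂ → ℂ) x =
      (betaIntegral a δ)⁻¹ * ∫ s, betaW a δ s * f s ∂unitMeasure := by
  have h := hasSum_integral_weight (integrable_betaW ha hδ) hc
    (m := fun n s => (s : ℂ) ^ n) (f := f)
    (fun n => by fun_prop)
    (fun n => unitMeasure_ae_mem.mono fun s hs => by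
      rw [norm_pow, norm_real, Real.norm_of_nonneg hs.1.le]
      exact pow_le_one₀ hs.1.le hs.2.le)
    (unitMeasure_ae_mem.mono fun s hs => by
      convert hf s hs using 2
      rw [mul_pow]; ring)
  simp_rw [integral_betaW_mul_pow ha hδ] at h
  rw [ordinaryHypergeometric_eq_tsum_poch, ← h.tsum_eq, ← tsum_mul_left]
  refine tsum_congr fun n => ?_
  have := betaIntegral_ne_zero ha hδ
  field_simp

/-! ### Uniqueness of continuations and holomorphy of parameter integrals -/

section Continuation
variable {E : Type*} [NormedAddCommGroup E] [NormedSpace ℂ E]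

/-- Identity theorem on an open set that is star-shaped about a point. -/
lemma eqOn_of_starConvex {U V : Set E} {p₀ : E} (hU : IsOpen U) (hs : StarConvex ℝ p₀ U)
    (hp₀ : p₀ ∈ U) (hV : V ∈ 𝓝 p₀) {F G : E → ℂ} (hF : DifferentiableOn ℂ F U)
    (hG : DifferentiableOn ℂ G U) (h : EqOn F G V) : EqOn F G U := by
  intro p hp
  -- Restriction to the complex line through p₀ and p reduces the claim to one variable: the
  -- preimage of U is star-shaped about 0, hence connected, and contains 1.
  let φ : ℂ → E := fun z => p₀ + z • (p - p₀)
  have hφ : Differentiable ℂ φ := by fun_prop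
  have hφ0 : φ 0 = p₀ := by simp [φ]
  have hφ1 : φ 1 = p := by simp [φ]
  have hW : IsOpen (φ ⁻¹' U) := hU.preimage hφ.continuous
  have h0 : (0 : ℂ) ∈ φ ⁻¹' U := by simpa [hφ0] using hp₀
  have hstar : StarConvex ℝ 0 (φ ⁻¹' U) := by
    intro z hz a b ha hb hab
    have := hs hz ha hb hab
    have e : φ (a • 0 + b • z) = a • p₀ + b • φ z := by
      simp only [φ, smul_zero, zero_add, smul_add, smul_assoc, ← add_assoc, ← add_smul, hab,
        one_smul]
    rwa [mem_preimage, e]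
  have hF' : DifferentiableOn ℂ (F ∘ φ) (φ ⁻¹' U) :=
    hF.comp hφ.differentiableOn (mapsTo_preimage _ _)
  have hG' : DifferentiableOn ℂ (G ∘ φ) (φ ⁻¹' U) :=
    hG.comp hφ.differentiableOn (mapsTo_preimage _ _)
  have hev : F ∘ φ =ᶠ[𝓝 0] G ∘ φ := by
    have : φ ⁻¹' V ∈ 𝓝 (0 : ℂ) := hφ.continuous.continuousAt (by rwa [hφ0])
    filter_upwards [this] with z hz using h hz
  have := (hF'.analyticOnNhd hW).eqOn_of_preconnected_of_eventuallyEq (hG'.analyticOnNhd hW)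
    (hstar.isPathConnected h0).isConnected.isPreconnected h0 hev
    (show (1 : ℂ) ∈ φ ⁻¹' U by simpa [hφ1] using hp)
  simpa [hφ1] using this

lemma isHolomorphicContinuation_holomorphicContinuation {f : E → ℂ} {V U : Set E} {F : E → ℂ}
    (hF : IsHolomorphicContinuation f V U F) :
    IsHolomorphicContinuation f V U (holomorphicContinuation f V U) := by
  have h : ∃ F : E → ℂ, IsHolomorphicContinuation f V U F := ⟨F, hF⟩
  rw [holomorphicContinuation, dif_pos h]
  exact Classical.choose_spec h

lemma holomorphicContinuation_eqOn {f : E → ℂ} {U V : Set E} {p₀ : E} (hU : IsOpen U)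
    (hs : StarConvex ℝ p₀ U) (hp₀ : p₀ ∈ U) (hV : V ∈ 𝓝 p₀) {F : E → ℂ}
    (hF : IsHolomorphicContinuation f V U F) : EqOn (holomorphicContinuation f V U) F U := by
  have h := isHolomorphicContinuation_holomorphicContinuation hF
  exact eqOn_of_starConvex hU hs hp₀ hV h.1 hF.1 (h.2.trans hF.2.symm)

/-- Holomorphy of a parameter integral against an integrable weight, with a kernel that is
continuously differentiable in the parameter, uniformly over a compact set. -/
lemma differentiableOn_integral_weight [LocallyCompactSpace E] {α : Type*} [MetricSpace α]
    [SecondCountableTopology α] [MeasurableSpace α] [BorelSpace α] {μ : Measure α} {S : Set α}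
    (hS : IsCompact S) (hμ : ∀ᵐ s ∂μ, s ∈ S) {w : α → ℂ} (hw : Integrable w μ) {U : Set E}
    (hU : IsOpen U) {k : E → α → ℂ} {k' : E → α → E →L[ℂ] ℂ}
    (hk : ContinuousOn (Function.uncurry k) (U ×ˢ S))
    (hk' : ContinuousOn (Function.uncurry k') (U ×ˢ S))
    (hd : ∀ p ∈ U, ∀ s ∈ S, HasFDerivAt (fun p => k p s) (k' p s) p) :
    DifferentiableOn ℂ (fun p => ∫ s, w s * k p s ∂μ) U := by
  intro p₀ hp₀
  have hμS : μ.restrict S = μ := Measure.restrict_eq_self_of_ae_mem hμ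
  obtain ⟨K, hK, hKU, hKc⟩ := local_compact_nhds (hU.mem_nhds hp₀)
  have hmeas : ∀ p ∈ U, AEStronglyMeasurable (k p) μ := fun p hp => by
    rw [← hμS]
    refine ContinuousOn.aestronglyMeasurable ?_ hS.measurableSet
    exact hk.comp (f := fun s => (p, s)) (by fun_prop) fun s hs => ⟨hp, hs⟩
  have hmeas' : ∀ p ∈ U, AEStronglyMeasurable (k' p) μ := fun p hp => by
    rw [← hμS]
    refine ContinuousOn.aestronglyMeasurable_of_isCompact ?_ hS hS.measurableSet
    exact hk'.comp (f := fun s => (p, s)) (by fun_prop) fun s hs => ⟨hp, hs⟩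
  -- Compactness of K × S bounds the derivative of the kernel uniformly, so M‖w‖ dominates the
  -- differentiated integrand.
  obtain ⟨M, hM⟩ := (hKc.prod hS).exists_bound_of_continuousOn
    (hk'.mono (prod_mono hKU subset_rfl))
  obtain ⟨N, hN⟩ := (hKc.prod hS).exists_bound_of_continuousOn
    (hk.mono (prod_mono hKU subset_rfl))
  have hp₀K : p₀ ∈ K := mem_of_mem_nhds hK
  refine (hasFDerivAt_integral_of_dominated_of_fderiv_le (μ := μ) (𝕜 := ℂ)
    (F' := fun p s => w s • k' p s) (bound := fun s => M * ‖w s‖) hK ?_ ?_ ?_ ?_ ?_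
    ?_).differentiableAt.differentiableWithinAt
  · filter_upwards [hU.mem_nhds hp₀] with p hp using hw.aestronglyMeasurable.mul (hmeas p hp)
  · refine hw.mul_bdd (c := N) (hmeas p₀ hp₀) ?_
    filter_upwards [hμ] with s hs using hN (p₀, s) ⟨hp₀K, hs⟩
  · exact hw.aestronglyMeasurable.smul (hmeas' p₀ hp₀)
  · filter_upwards [hμ] with s hs p hp
    rw [norm_smul, mul_comm]
    gcongr
    exact hM (p, s) ⟨hp, hs⟩
  · exact hw.norm.const_mul _
  · filter_upwards [hμ] with s hs p hp
    exact (hd p (hKU hp) s hs).const_mul (w s)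

end Continuation

/-! ### Geometry of the cut domains -/

section Domains

lemma notMem_ofReal_Iic_iff {y : ℂ} : y ∉ ofReal '' Iic 0 ↔ y ∈ slitPlane := by
  rw [mem_slitPlane_iff, not_iff_comm, not_or, not_lt, not_ne_iff]
  constructor
  · rintro ⟨h1, h2⟩
    exact ⟨y.re, h1, Complex.ext (by simp) (by simp [h2])⟩
  · rintro ⟨r, hr, rfl⟩
    exact ⟨by simpa using hr, by simp⟩

lemma notMem_ofReal_Ici_iff {x : ℂ} : x ∉ ofReal '' Ici 1 ↔ 1 - x ∈ slitPlane := by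
  rw [← notMem_ofReal_Iic_iff, not_iff_not]
  constructor
  · rintro ⟨r, hr, rfl⟩
    exact ⟨1 - r, by simpa using hr, by simp⟩
  · rintro ⟨r, hr, h⟩
    exact ⟨1 - r, by simpa using hr, by simp [h]⟩

lemma mem_gaussDomain {x : ℂ} : x ∈ gaussDomain ↔ 1 - x ∈ slitPlane := notMem_ofReal_Ici_iff

lemma mem_olssonDomain {p : ℂ × ℂ} :
    p ∈ olssonDomain ↔ 1 - p.1 ∈ slitPlane ∧ p.2 ∈ slitPlane :=
  and_congr notMem_ofReal_Ici_iff notMem_ofReal_Iic_iff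

lemma isOpen_gaussDomain : IsOpen gaussDomain := by
  have : gaussDomain = (fun x => 1 - x) ⁻¹' slitPlane := ext fun x => mem_gaussDomain
  rw [this]
  exact isOpen_slitPlane.preimage (by fun_prop)

lemma isOpen_olssonDomain : IsOpen olssonDomain := by
  have : olssonDomain = (fun p : ℂ × ℂ => 1 - p.1) ⁻¹' slitPlane ∩ Prod.snd ⁻¹' slitPlane :=
    ext fun p => mem_olssonDomain
  rw [this]
  exact (isOpen_slitPlane.preimage (by fun_prop)).inter (isOpen_slitPlane.preimage (by fun_prop))

lemma starConvex_gaussDomain : StarConvex ℝ 0 gaussDomain := by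
  intro x hx a b ha hb hab
  rw [mem_gaussDomain] at hx ⊢
  have := starConvex_one_slitPlane hx ha hb hab
  convert this using 1
  have hab' : (a : ℂ) + b = 1 := by exact_mod_cast hab
  simp only [real_smul]
  linear_combination -hab'

lemma starConvex_olssonDomain : StarConvex ℝ ((0, 1) : ℂ × ℂ) olssonDomain := by
  intro p hp a b ha hb hab
  rw [mem_olssonDomain] at hp ⊢
  refine ⟨?_, starConvex_one_slitPlane hp.2 ha hb hab⟩
  exact mem_gaussDomain.1 (starConvex_gaussDomain (mem_gaussDomain.2 hp.1) ha hb hab)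

/-- The point lies on the segment from 1 to 1 - x. This keeps the Euler kernels regular up to the
boundary of the range of integration. -/
lemma one_sub_mul_mem_slitPlane {x : ℂ} (hx : 1 - x ∈ slitPlane) {t : ℝ}
    (ht : t ∈ Icc (0 : ℝ) 1) : 1 - x * t ∈ slitPlane := by
  have := starConvex_one_slitPlane hx (sub_nonneg.2 ht.2) ht.1 (by ring)
  convert this using 1
  simp only [real_smul, ofReal_sub, ofReal_one]
  ring

lemma gaussDomain_zero_mem : (0 : ℂ) ∈ gaussDomain := by simp [mem_gaussDomain]

lemma olssonDomain_zero_one_mem : ((0, 1) : ℂ × ℂ) ∈ olssonDomain := by simp [mem_olssonDomain]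

lemma olssonPolydisc_mem_nhds : olssonPolydisc ∈ 𝓝 ((0, 1) : ℂ × ℂ) := by
  have h₁ : IsOpen {p : ℂ × ℂ | ‖p.1‖ < 1} := isOpen_lt (by fun_prop) continuous_const
  have h₂ : IsOpen {p : ℂ × ℂ | ‖p.2 - 1‖ < 1} := isOpen_lt (by fun_prop) continuous_const
  have : IsOpen olssonPolydisc := h₁.inter h₂
  exact this.mem_nhds (by simp [olssonPolydisc])

end Domains

/-! ### Regularity of the power kernels -/

section Kernel
variable {E : Type*} [NormedAddCommGroup E] [NormedSpace ℂ E]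

lemma hasFDerivAt_one_sub_mul_cpow {ℓ : E → ℂ} {ℓ' : E →L[ℂ] ℂ} {p : E}
    (hℓ : HasFDerivAt ℓ ℓ' p) (b τ : ℂ) (h : 1 - ℓ p * τ ∈ slitPlane) :
    HasFDerivAt (fun p => (1 - ℓ p * τ) ^ b) ((-(b * (1 - ℓ p * τ) ^ (b - 1) * τ)) • ℓ') p := by
  have h1 : HasFDerivAt (fun p => 1 - ℓ p * τ) (-(τ • ℓ')) p := (hℓ.mul_const τ).const_sub 1
  have h2 := (hasStrictDerivAt_cpow_const (c := b) h).hasDerivAt.comp_hasFDerivAt p h1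
  refine h2.congr_fderiv ?_
  ext v
  simp
  ring

lemma continuousOn_one_sub_mul_cpow {X : Type*} [TopologicalSpace X] {T : Set X} {f g : X → ℂ}
    (hf : ContinuousOn f T) (hg : ContinuousOn g T) (b : ℂ)
    (h : ∀ q ∈ T, 1 - f q * g q ∈ slitPlane) :
    ContinuousOn (fun q => (1 - f q * g q) ^ b) T :=
  ContinuousOn.cpow (continuousOn_const.sub (hf.mul hg)) continuousOn_const h

lemma continuousOn_one_sub_mul_cpow_smul {X : Type*} [TopologicalSpace X] {T : Set X}
    {f g : X → ℂ} (hf : ContinuousOn f T) (hg : ContinuousOn g T) (b : ℂ)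
    (h : ∀ q ∈ T, 1 - f q * g q ∈ slitPlane) (L : E →L[ℂ] ℂ) :
    ContinuousOn (fun q => (-(b * (1 - f q * g q) ^ (b - 1) * g q)) • L) T := by
  have := continuousOn_one_sub_mul_cpow hf hg (b - 1) h
  fun_prop

end Kernel

/-! ### Euler's integral for ₂F₁ -/

section Gauss

/-- Euler's integral for the Gauss hypergeometric function with parameters `a, b; a + δ`. -/
noncomputable def gaussIntegral (a b δ x : ℂ) : ℂ :=
  (betaIntegral a δ)⁻¹ * ∫ s, betaW a δ s * (1 - x * s) ^ (-b) ∂unitMeasure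

lemma unitMeasure_ae_mem_Icc : ∀ᵐ s ∂unitMeasure, s ∈ Icc (0 : ℝ) 1 :=
  unitMeasure_ae_mem.mono fun _ hs => Ioo_subset_Icc_self hs

lemma differentiableOn_gaussIntegral {a b δ : ℂ} (ha : 0 < a.re) (hδ : 0 < δ.re) :
    DifferentiableOn ℂ (gaussIntegral a b δ) gaussDomain := by
  have hmem : ∀ q ∈ gaussDomain ×ˢ Icc (0 : ℝ) 1, 1 - q.1 * (q.2 : ℂ) ∈ slitPlane :=
    fun q hq => one_sub_mul_mem_slitPlane (mem_gaussDomain.1 hq.1) hq.2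
  refine DifferentiableOn.const_mul ?_ _
  refine differentiableOn_integral_weight (isCompact_Icc (a := (0 : ℝ)) (b := 1))
    unitMeasure_ae_mem_Icc (integrable_betaW ha hδ) isOpen_gaussDomain
    (k' := fun x s => (-(-b * (1 - x * s) ^ (-b - 1) * s)) • ContinuousLinearMap.id ℂ ℂ) ?_ ?_ ?_
  · exact continuousOn_one_sub_mul_cpow (by fun_prop) (by fun_prop) _ hmem
  · exact continuousOn_one_sub_mul_cpow_smul (by fun_prop) (by fun_prop) _ hmem _
  · intro x hx s hs
    exact hasFDerivAt_one_sub_mul_cpow (hasFDerivAt_id x) _ _ (hmem (x, s) ⟨hx, hs⟩)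

lemma norm_mul_ofReal_lt {x : ℂ} (hx : ‖x‖ < 1) {s : ℝ} (hs : s ∈ Ioo (0 : ℝ) 1) :
    ‖x * s‖ < 1 := by
  rw [norm_mul, norm_real, Real.norm_of_nonneg hs.1.le]
  exact (mul_le_of_le_one_right (norm_nonneg x) hs.2.le).trans_lt hx

lemma isHolomorphicContinuation_gaussIntegral {a b δ : ℂ} (ha : 0 < a.re) (hδ : 0 < δ.re) :
    IsHolomorphicContinuation (ordinaryHypergeometric a b (a + δ) : ℂ → ℂ) (Metric.ball 0 1)
      gaussDomain (gaussIntegral a b δ) := by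
  refine ⟨differentiableOn_gaussIntegral ha hδ, fun x hx => ?_⟩
  rw [mem_ball_zero_iff] at hx
  exact (ordinaryHypergeometric_eq_integral ha hδ (summable_norm_binomial b hx) fun s hs =>
    hasSum_binomial b (norm_mul_ofReal_lt hx hs)).symm

lemma gaussF_eq_gaussIntegral {a b δ x : ℂ} (ha : 0 < a.re) (hδ : 0 < δ.re)
    (hx : x ∈ gaussDomain) : gaussF a b (a + δ) x = gaussIntegral a b δ x :=
  holomorphicContinuation_eqOn isOpen_gaussDomain starConvex_gaussDomain gaussDomain_zero_mem
    (Metric.ball_mem_nhds 0 one_pos) (isHolomorphicContinuation_gaussIntegral ha hδ) hx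

/-- Euler's integral for a terminating hypergeometric series. -/
lemma ordinaryHypergeometric_neg_natCast_eq_integral {a δ : ℂ} (ha : 0 < a.re) (hδ : 0 < δ.re)
    (i : ℕ) (w : ℂ) :
    (ordinaryHypergeometric (-(i : ℂ)) a (a + δ) : ℂ → ℂ) w =
      (betaIntegral a δ)⁻¹ * ∫ s, betaW a δ s * (1 - w * s) ^ i ∂unitMeasure := by
  -- The upper parameters are exchanged: the one in the beta weight needs positive real part, while
  -- -i goes into the binomial series.
  rw [ordinaryHypergeometric, ordinaryHypergeometricSeries_symm, ← ordinaryHypergeometric]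
  exact ordinaryHypergeometric_eq_integral ha hδ
    (hasSum_binomial_neg_natCast i w).summable.norm fun s _ => hasSum_binomial_neg_natCast i _

end Gauss

/-! ### The double Euler integral for F_P -/

section Olsson

lemma hasSum_prod_mul {f g : ℕ → ℂ} {S T : ℂ} (hf : HasSum f S) (hg : HasSum g T) :
    HasSum (fun n : ℕ × ℕ => f n.1 * g n.2) (S * T) :=
  hf.mul hg (summable_mul_of_summable_norm hf.summable.norm hg.summable.norm)

/-- The weight `u ^ (p - 1) (1 - u) ^ (δ - 1) v ^ (a - 1) (1 - v) ^ (β - 1)` on the unit square. -/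
noncomputable def olssonWeight (a β p δ : ℂ) (z : ℝ × ℝ) : ℂ := betaW p δ z.1 * betaW a β z.2

/-- The kernel `(1 - x u v) ^ (-b₁) (1 - v (1 - y)) ^ (-b₂)`. -/
noncomputable def olssonKernel (b₁ b₂ : ℂ) (q : ℂ × ℂ) (z : ℝ × ℝ) : ℂ :=
  (1 - q.1 * (z.1 * z.2 : ℝ)) ^ (-b₁) * (1 - (1 - q.2) * z.2) ^ (-b₂)

/-- The double integral of Euler type that represents Olsson's function, up to a constant. -/
noncomputable def olssonIntegral (a β p δ b₁ b₂ : ℂ) (q : ℂ × ℂ) : ℂ :=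
  ∫ z, olssonWeight a β p δ z * olssonKernel b₁ b₂ q z ∂(unitMeasure.prod unitMeasure)

lemma integrable_olssonWeight {a β p δ : ℂ} (ha : 0 < a.re) (hβ : 0 < β.re) (hp : 0 < p.re)
    (hδ : 0 < δ.re) : Integrable (olssonWeight a β p δ) (unitMeasure.prod unitMeasure) :=
  (integrable_betaW hp hδ).mul_prod (integrable_betaW ha hβ)

lemma unitMeasure_prod_ae_mem_Icc :
    ∀ᵐ z ∂(unitMeasure.prod unitMeasure), z ∈ Icc (0 : ℝ) 1 ×ˢ Icc (0 : ℝ) 1 :=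
  unitMeasure_prod_ae_mem.mono fun _ hz => ⟨Ioo_subset_Icc_self hz.1, Ioo_subset_Icc_self hz.2⟩

lemma mul_mem_Icc {z : ℝ × ℝ} (hz : z ∈ Icc (0 : ℝ) 1 ×ˢ Icc (0 : ℝ) 1) :
    z.1 * z.2 ∈ Icc (0 : ℝ) 1 :=
  ⟨mul_nonneg hz.1.1 hz.2.1, mul_le_one₀ hz.1.2 hz.2.1 hz.2.2⟩

lemma olssonKernel_mem {q : (ℂ × ℂ) × (ℝ × ℝ)}
    (hq : q ∈ olssonDomain ×ˢ (Icc (0 : ℝ) 1 ×ˢ Icc (0 : ℝ) 1)) :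
    1 - q.1.1 * (q.2.1 * q.2.2 : ℝ) ∈ slitPlane ∧ 1 - (1 - q.1.2) * q.2.2 ∈ slitPlane :=
  ⟨one_sub_mul_mem_slitPlane (mem_olssonDomain.1 hq.1).1 (mul_mem_Icc hq.2),
    one_sub_mul_mem_slitPlane (by simpa using (mem_olssonDomain.1 hq.1).2) hq.2.2⟩

lemma continuousOn_olssonKernel (b₁ b₂ : ℂ) :
    ContinuousOn (Function.uncurry (olssonKernel b₁ b₂))
      (olssonDomain ×ˢ (Icc (0 : ℝ) 1 ×ˢ Icc (0 : ℝ) 1)) :=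
  (continuousOn_one_sub_mul_cpow (by fun_prop) (by fun_prop) _ fun _ hq =>
      (olssonKernel_mem hq).1).mul
    (continuousOn_one_sub_mul_cpow (by fun_prop) (by fun_prop) _ fun _ hq =>
      (olssonKernel_mem hq).2)

lemma differentiableOn_olssonIntegral {a β p δ : ℂ} (ha : 0 < a.re) (hβ : 0 < β.re)
    (hp : 0 < p.re) (hδ : 0 < δ.re) (b₁ b₂ : ℂ) :
    DifferentiableOn ℂ (olssonIntegral a β p δ b₁ b₂) olssonDomain := by
  have h₁ : ∀ b : ℂ, ContinuousOn (fun q : (ℂ × ℂ) × (ℝ × ℝ) =>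
      (1 - q.1.1 * (q.2.1 * q.2.2 : ℝ)) ^ b)
      (olssonDomain ×ˢ (Icc (0 : ℝ) 1 ×ˢ Icc (0 : ℝ) 1)) := fun b =>
    continuousOn_one_sub_mul_cpow (by fun_prop) (by fun_prop) _ fun q hq => (olssonKernel_mem hq).1
  have h₂ : ∀ b : ℂ, ContinuousOn (fun q : (ℂ × ℂ) × (ℝ × ℝ) =>
      (1 - (1 - q.1.2) * q.2.2) ^ b)
      (olssonDomain ×ˢ (Icc (0 : ℝ) 1 ×ˢ Icc (0 : ℝ) 1)) := fun b =>
    continuousOn_one_sub_mul_cpow (by fun_prop) (by fun_prop) _ fun q hq => (olssonKernel_mem hq).2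
  refine differentiableOn_integral_weight
    ((isCompact_Icc (a := (0 : ℝ)) (b := 1)).prod (isCompact_Icc (a := (0 : ℝ)) (b := 1)))
    unitMeasure_prod_ae_mem_Icc (integrable_olssonWeight ha hβ hp hδ) isOpen_olssonDomain
    (k' := fun q z => (1 - q.1 * (z.1 * z.2 : ℝ)) ^ (-b₁) •
        ((-(-b₂ * (1 - (1 - q.2) * z.2) ^ (-b₂ - 1) * z.2)) • (-ContinuousLinearMap.snd ℂ ℂ ℂ)) +
      (1 - (1 - q.2) * z.2) ^ (-b₂) •
        ((-(-b₁ * (1 - q.1 * (z.1 * z.2 : ℝ)) ^ (-b₁ - 1) * (z.1 * z.2 : ℝ))) •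
          ContinuousLinearMap.fst ℂ ℂ ℂ)) (continuousOn_olssonKernel b₁ b₂) ?_ ?_
  · exact ((h₁ _).smul (continuousOn_one_sub_mul_cpow_smul (by fun_prop) (by fun_prop) _
        (fun q hq => (olssonKernel_mem hq).2) _)).add
      ((h₂ _).smul (continuousOn_one_sub_mul_cpow_smul (by fun_prop) (by fun_prop) _
        (fun q hq => (olssonKernel_mem hq).1) _))
  · intro q hq z hz
    have hm := olssonKernel_mem (q := (q, z)) ⟨hq, hz⟩
    exact (hasFDerivAt_one_sub_mul_cpow hasFDerivAt_fst (-b₁) _ hm.1).mul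
      (hasFDerivAt_one_sub_mul_cpow (hasFDerivAt_snd.const_sub 1) (-b₂) _ hm.2)

lemma integral_olssonWeight_mul_pow {a β p δ : ℂ} (ha : 0 < a.re) (hβ : 0 < β.re)
    (hp : 0 < p.re) (hδ : 0 < δ.re) (i j : ℕ) :
    ∫ z, olssonWeight a β p δ z * (((z.1 * z.2 : ℝ) : ℂ) ^ i * (z.2 : ℂ) ^ j)
        ∂(unitMeasure.prod unitMeasure) =
      poch p i / poch (p + δ) i * betaIntegral p δ *
        (poch a (i + j) / poch (a + β) (i + j) * betaIntegral a β) := by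
  rw [← integral_betaW_mul_pow hp hδ, ← integral_betaW_mul_pow ha hβ, ← integral_prod_mul]
  refine integral_congr_ae (ae_of_all _ fun z => ?_)
  simp only [olssonWeight, ofReal_mul, mul_pow, pow_add]
  ring

/-- On the polydisc both kernel factors have binomial expansions. The monomial (uv)^i v^j carries
u^i and v^(i+j), whose normalized beta moments are (p)_i/(c₁)_i and (a)_{i+j}/(a + β)_{i+j}; the
first numerator is the factor (a - c₂ + 1)_i of the series. -/
lemma isHolomorphicContinuation_olssonIntegral {a b₁ b₂ c₁ c₂ : ℂ} (ha : 0 < a.re)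
    (hβ : 0 < (b₂ - c₂ + 1).re) (hp : 0 < (a - c₂ + 1).re) (hδ : 0 < (c₁ + c₂ - a - 1).re) :
    IsHolomorphicContinuation (olssonSeries a b₁ b₂ c₁ c₂) olssonPolydisc olssonDomain
      (fun q => (betaIntegral a (b₂ - c₂ + 1) * betaIntegral (a - c₂ + 1) (c₁ + c₂ - a - 1))⁻¹ *
        olssonIntegral a (b₂ - c₂ + 1) (a - c₂ + 1) (c₁ + c₂ - a - 1) b₁ b₂ q) := by
  refine ⟨(differentiableOn_olssonIntegral ha hβ hp hδ b₁ b₂).const_mul _, ?_⟩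
  rintro ⟨x, y⟩ ⟨hx, hy⟩
  replace hx : ‖x‖ < 1 := hx
  replace hy : ‖1 - y‖ < 1 := by rw [norm_sub_rev]; exact hy
  have hB₁ := betaIntegral_ne_zero ha hβ
  have hB₂ := betaIntegral_ne_zero hp hδ
  have h := hasSum_integral_weight (integrable_olssonWeight ha hβ hp hδ)
    (c := fun n : ℕ × ℕ => poch b₁ n.1 / n.1.factorial * x ^ n.1 *
      (poch b₂ n.2 / n.2.factorial * (1 - y) ^ n.2))
    (m := fun n z => ((z.1 * z.2 : ℝ) : ℂ) ^ n.1 * (z.2 : ℂ) ^ n.2)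
    (f := olssonKernel b₁ b₂ (x, y)) ?_ (fun n => by fun_prop) ?_ ?_
  · simp_rw [integral_olssonWeight_mul_pow ha hβ hp hδ] at h
    beta_reduce
    rw [olssonIntegral, ← h.tsum_eq, ← tsum_mul_left, olssonSeries]
    refine tsum_congr fun n => ?_
    rw [show a - c₂ + 1 + (c₁ + c₂ - a - 1) = c₁ by ring,
      show a + (b₂ - c₂ + 1) = a + b₂ - c₂ + 1 by ring]
    field_simp
  · exact (hasSum_prod_mul (hasSum_binomial b₁ hx) (hasSum_binomial b₂ hy)).summable.norm
  · intro n
    filter_upwards [unitMeasure_prod_ae_mem_Icc] with z hz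
    have h1 := mul_mem_Icc hz
    rw [norm_mul, norm_pow, norm_pow, norm_real, norm_real, Real.norm_of_nonneg h1.1,
      Real.norm_of_nonneg hz.2.1]
    exact mul_le_one₀ (pow_le_one₀ h1.1 h1.2) (pow_nonneg hz.2.1 _) (pow_le_one₀ hz.2.1 hz.2.2)
  · filter_upwards [unitMeasure_prod_ae_mem] with z hz
    have h1 : z.1 * z.2 ∈ Ioo (0 : ℝ) 1 :=
      ⟨mul_pos hz.1.1 hz.2.1, mul_lt_one_of_nonneg_of_lt_one_left hz.1.1.le hz.1.2 hz.2.2.le⟩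
    have hx' := norm_mul_ofReal_lt hx h1
    have hy' := norm_mul_ofReal_lt hy hz.2
    have := hasSum_prod_mul (hasSum_binomial b₁ hx') (hasSum_binomial b₂ hy')
    rw [olssonKernel]
    convert! this using 1
    ext n
    simp only [mul_pow]
    ring

end Olsson

/-! ### Change of variables on the triangle -/

section Triangle

/-- Substitution `t = u v` in an integral over `0 < t < u`. -/
lemma integral_indicator_comp_mul {E : Type*} [NormedAddCommGroup E] [NormedSpace ℝ E]
    (f : ℝ → E) {u : ℝ} (hu : 0 < u) :
    ∫ t, (Ioo 0 u).indicator f t = ∫ v, u • f (u * v) ∂unitMeasure := by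
  have h := Measure.integral_comp_mul_left ((Ioo 0 u).indicator f) u
  have e : (fun v => (Ioo 0 u).indicator f (u * v)) =
      (Ioo (0 : ℝ) 1).indicator fun v => f (u * v) := by
    ext v
    simp only [indicator, mem_Ioo, mul_pos_iff_of_pos_left hu, mul_lt_iff_lt_one_right hu]
  rw [e, integral_indicator measurableSet_Ioo, abs_of_pos (inv_pos.2 hu)] at h
  rw [integral_smul, h, smul_inv_smul₀ hu.ne']

lemma integrable_indicator_of_comp_mul {E : Type*} [NormedAddCommGroup E] [NormedSpace ℝ E]
    (f : ℝ → E) {u : ℝ} (hu : 0 < u) (h : Integrable (fun v => u • f (u * v)) unitMeasure) :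
    Integrable ((Ioo 0 u).indicator f) := by
  rw [← integrable_comp_mul_left_iff _ hu.ne']
  have e : (fun v => (Ioo 0 u).indicator f (u * v)) =
      (Ioo (0 : ℝ) 1).indicator fun v => f (u * v) := by
    ext v
    simp only [indicator, mem_Ioo, mul_pos_iff_of_pos_left hu, mul_lt_iff_lt_one_right hu]
  rw [e, integrable_indicator_iff measurableSet_Ioo]
  exact (integrable_smul_iff hu.ne' _).1 h

/-- Substitution `u = t + (1 - t) s` in an integral over `t < u < 1`. -/
lemma integral_indicator_comp_affine {E : Type*} [NormedAddCommGroup E] [NormedSpace ℝ E]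
    (f : ℝ → E) {t : ℝ} (ht : t < 1) :
    ∫ u, (Ioo t 1).indicator f u = ∫ s, (1 - t) • f (t + (1 - t) * s) ∂unitMeasure := by
  -- Translation by t reduces this to the scaling substitution on (0, 1 - t).
  have h := integral_indicator_comp_mul (fun u => f (t + u)) (sub_pos.2 ht)
  rw [← h, ← integral_add_left_eq_self _ t]
  congr 1
  ext u
  simp only [indicator, mem_Ioo, lt_add_iff_pos_right, lt_sub_iff_add_lt']

/-- Integration over the triangle `0 < t < u < 1` in two systems of coordinates on the unit
square: `(t, t + (1 - t) s)` and `(u v, u)`. -/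
lemma integral_triangle {f : ℝ → ℝ → ℂ} (hf : Measurable (Function.uncurry f))
    (hg : Integrable (fun z : ℝ × ℝ => (z.1 : ℂ) * f (z.1 * z.2) z.1)
      (unitMeasure.prod unitMeasure)) :
    ∫ t, ∫ s, (1 - t : ℂ) * f t (t + (1 - t) * s) ∂unitMeasure ∂unitMeasure =
      ∫ z : ℝ × ℝ, (z.1 : ℂ) * f (z.1 * z.2) z.1 ∂(unitMeasure.prod unitMeasure) := by
  let T : Set (ℝ × ℝ) := {z | z.1 < z.2}
  have hT : MeasurableSet T := measurableSet_lt measurable_fst measurable_snd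
  let Φ : ℝ × ℝ → ℂ := T.indicator (Function.uncurry f)
  have hΦ : Measurable Φ := hf.indicator hT
  -- It is used with φ the identity and with φ the norm; φ 0 = 0 is needed because Φ vanishes off
  -- the triangle.
  have hcol : ∀ u ∈ Ioo (0 : ℝ) 1, ∀ φ : ℂ → ℂ, φ 0 = 0 →
      (Ioo (0 : ℝ) 1).indicator (fun t => φ (Φ (t, u))) =
        (Ioo 0 u).indicator fun t => φ (f t u) := by
    intro u hu φ hφ
    ext t
    by_cases h : 0 < t ∧ t < u
    · rw [indicator_of_mem (show t ∈ Ioo (0 : ℝ) 1 from ⟨h.1, h.2.trans hu.2⟩),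
        indicator_of_mem (show t ∈ Ioo 0 u from h)]
      simp only [Φ, indicator_of_mem (show (t, u) ∈ T from h.2)]
      rfl
    · rw [indicator_of_notMem (show t ∉ Ioo 0 u from h)]
      by_cases h0 : t ∈ Ioo (0 : ℝ) 1
      · rw [indicator_of_mem h0]
        simp only [Φ, indicator_of_notMem (show (t, u) ∉ T from fun h' => h ⟨h0.1, h'⟩), hφ]
      · rw [indicator_of_notMem h0]
  -- Fubini on the square needs integrability of Φ, which is transported column by column from `hg`
  -- by t = uv.
  have hint : Integrable Φ (unitMeasure.prod unitMeasure) := by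
    rw [integrable_prod_iff' hΦ.aestronglyMeasurable]
    constructor
    · filter_upwards [hg.prod_right_ae, unitMeasure_ae_mem] with u hu hu01
      have := hcol u hu01 id rfl
      simp only [id] at this
      rw [← IntegrableOn, ← integrable_indicator_iff measurableSet_Ioo, this]
      exact integrable_indicator_of_comp_mul _ hu01.1 (by simpa using hu)
    · refine hg.integral_norm_prod_left.congr ?_
      filter_upwards [unitMeasure_ae_mem] with u hu01
      have h := integral_indicator_comp_mul (fun t => ‖f t u‖) hu01.1
      have h2 : (Ioo (0 : ℝ) 1).indicator (fun t => ‖Φ (t, u)‖) =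
          (Ioo 0 u).indicator fun t => ‖f t u‖ := by
        have := hcol u hu01 (fun z => (‖z‖ : ℂ)) (by simp)
        ext t
        have := congrFun this t
        rw [← ofReal_inj]
        simpa only [indicator, apply_ite ofReal, ofReal_zero] using this
      rw [← integral_indicator (f := fun t => ‖Φ (t, u)‖) measurableSet_Ioo, h2, h]
      simp [abs_of_pos hu01.1]
  have hswap := integral_integral_swap (f := fun t u => Φ (t, u)) hint
  rw [integral_prod _ hg]
  refine Eq.trans ?_ (hswap.trans ?_)
  · refine integral_congr_ae (unitMeasure_ae_mem.mono fun t ht => ?_)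
    have h := integral_indicator_comp_affine (f t) ht.2
    have h2 : (Ioo (0 : ℝ) 1).indicator (fun u => Φ (t, u)) = (Ioo t 1).indicator (f t) := by
      ext u
      by_cases h : t < u ∧ u < 1
      · rw [indicator_of_mem (show u ∈ Ioo (0 : ℝ) 1 from ⟨ht.1.trans h.1, h.2⟩),
          indicator_of_mem (show u ∈ Ioo t 1 from h)]
        exact indicator_of_mem (show (t, u) ∈ T from h.1) _
      · rw [indicator_of_notMem (show u ∉ Ioo t 1 from h)]
        by_cases h0 : u ∈ Ioo (0 : ℝ) 1
        · rw [indicator_of_mem h0]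
          exact indicator_of_notMem (show (t, u) ∉ T from fun h' => h ⟨h', h0.2⟩) _
        · rw [indicator_of_notMem h0]
    beta_reduce
    rw [← integral_indicator (f := fun u => Φ (t, u)) measurableSet_Ioo, h2, h]
    simp
  · refine integral_congr_ae (unitMeasure_ae_mem.mono fun u hu => ?_)
    have h := integral_indicator_comp_mul (fun t => f t u) hu.1
    have h2 := hcol u hu id rfl
    simp only [id] at h2
    beta_reduce
    rw [← integral_indicator (f := fun t => Φ (t, u)) measurableSet_Ioo, h2, h]
    simp

end Triangle

/-! ### Principal powers of products and the new coordinates -/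

lemma mul_cpow_of_arg {x y : ℂ} (hx : x ≠ 0) (hy : y ≠ 0)
    (h : x.arg + y.arg ∈ Ioc (-Real.pi) Real.pi) (c : ℂ) : (x * y) ^ c = x ^ c * y ^ c := by
  rw [cpow_def_of_ne_zero (mul_ne_zero hx hy), cpow_def_of_ne_zero hx, cpow_def_of_ne_zero hy,
    (log_mul_eq_add_log_iff hx hy).2 h, add_mul, exp_add]

lemma ofReal_mul_cpow {r : ℝ} (hr : 0 < r) {z : ℂ} (hz : z ≠ 0) (c : ℂ) :
    ((r : ℂ) * z) ^ c = (r : ℂ) ^ c * z ^ c :=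
  mul_cpow_of_arg (ofReal_ne_zero.2 hr.ne') hz
    (by rw [arg_ofReal_of_nonneg hr.le, zero_add]; exact arg_mem_Ioc z) c

lemma mul_cpow_of_re_pos {x y : ℂ} (hx : 0 < x.re) (hy : 0 < y.re) (c : ℂ) :
    (x * y) ^ c = x ^ c * y ^ c := by
  have h1 := abs_lt.1 (abs_arg_lt_pi_div_two_iff.2 (Or.inl hx))
  have h2 := abs_lt.1 (abs_arg_lt_pi_div_two_iff.2 (Or.inl hy))
  refine mul_cpow_of_arg ?_ ?_ ⟨by linarith, by linarith⟩ c
  · rintro rfl; simp at hx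
  · rintro rfl; simp at hy

/-- The double integral for Olsson's function in the coordinates in which it expands into products
of hypergeometric functions. -/
lemma integral_eq_olssonIntegral {a β δ b₁ b₂ : ℂ} (ha : 0 < a.re) (hβ : 0 < β.re)
    (hδ : 0 < δ.re) (hp : 0 < (a + β - b₂).re) {x y : ℂ} (hxy : (x, y) ∈ olssonDomain) :
    ∫ t, ∫ s, betaW a (β + δ) t * betaW β δ s * (1 - x * t) ^ (-b₁) *
        (t * y + (1 - t) * s) ^ (-b₂) ∂unitMeasure ∂unitMeasure =
      olssonIntegral a β (a + β - b₂) δ b₁ b₂ (x, y) := by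
  -- This is the common integrand on the triangle; multiplied by the Jacobians u and 1 - t it yields
  -- the two sides.
  let f : ℝ → ℝ → ℂ := fun t u => (t : ℂ) ^ (a - 1) * ((u - t : ℝ) : ℂ) ^ (β - 1) *
    ((1 - u : ℝ) : ℂ) ^ (δ - 1) * (1 - x * t) ^ (-b₁) * (t * y + (u - t : ℝ)) ^ (-b₂)
  have hf : Measurable (Function.uncurry f) := by
    simp only [f, Function.uncurry_def]
    fun_prop
  have key : ∀ z ∈ Ioo (0 : ℝ) 1 ×ˢ Ioo (0 : ℝ) 1, (z.1 : ℂ) * f (z.1 * z.2) z.1 =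
      olssonWeight a β (a + β - b₂) δ z * olssonKernel b₁ b₂ (x, y) z := by
    rintro ⟨u, v⟩ ⟨hu, hv⟩
    have hu0 : (u : ℂ) ≠ 0 := ofReal_ne_zero.2 hu.1.ne'
    have hne := slitPlane_ne_zero (olssonKernel_mem (q := ((x, y), (u, v)))
      ⟨hxy, Ioo_subset_Icc_self hu, Ioo_subset_Icc_self hv⟩).2
    simp only at hne hu hv
    have e1 : ((u * v : ℝ) : ℂ) ^ (a - 1) = (u : ℂ) ^ (a - 1) * (v : ℂ) ^ (a - 1) := by
      rw [ofReal_mul, mul_cpow_ofReal_nonneg hu.1.le hv.1.le]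
    have e2 : ((u - u * v : ℝ) : ℂ) ^ (β - 1) = (u : ℂ) ^ (β - 1) * ((1 - v : ℝ) : ℂ) ^ (β - 1) := by
      rw [← mul_cpow_ofReal_nonneg hu.1.le (sub_nonneg.2 hv.2.le), ← ofReal_mul, mul_sub, mul_one]
    have e3 : (((u * v : ℝ) : ℂ) * y + (u - u * v : ℝ)) ^ (-b₂) =
        (u : ℂ) ^ (-b₂) * (1 - (1 - y) * v) ^ (-b₂) := by
      rw [← ofReal_mul_cpow hu.1 hne]
      congr 1
      push_cast
      ring
    -- The Jacobian counts as u^1, so the total exponent of u is p - 1 with p = a + β - b₂.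
    have e4 : (u : ℂ) * ((u : ℂ) ^ (a - 1) * (u : ℂ) ^ (β - 1) * (u : ℂ) ^ (-b₂)) =
        (u : ℂ) ^ (a + β - b₂ - 1) := by
      nth_rewrite 1 [← cpow_one (u : ℂ)]
      rw [← cpow_add _ _ hu0, ← cpow_add _ _ hu0, ← cpow_add _ _ hu0]
      congr 1
      ring
    simp only [f, olssonWeight, olssonKernel, betaW]
    rw [e1, e2, e3, ← e4]
    push_cast
    ring
  have hint : Integrable (fun z : ℝ × ℝ => (z.1 : ℂ) * f (z.1 * z.2) z.1)
      (unitMeasure.prod unitMeasure) := by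
    have hc : ContinuousOn (olssonKernel b₁ b₂ (x, y)) (Icc (0 : ℝ) 1 ×ˢ Icc (0 : ℝ) 1) :=
      (continuousOn_olssonKernel b₁ b₂).comp (f := fun z => ((x, y), z)) (by fun_prop)
        fun z hz => ⟨hxy, hz⟩
    have hS : IsCompact (Icc (0 : ℝ) 1 ×ˢ Icc (0 : ℝ) 1) := isCompact_Icc.prod isCompact_Icc
    obtain ⟨N, hN⟩ := hS.exists_bound_of_continuousOn hc
    have hm : AEStronglyMeasurable (olssonKernel b₁ b₂ (x, y)) (unitMeasure.prod unitMeasure) := by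
      rw [← Measure.restrict_eq_self_of_ae_mem unitMeasure_prod_ae_mem_Icc]
      exact hc.aestronglyMeasurable hS.measurableSet
    refine ((integrable_olssonWeight ha hβ hp hδ).mul_bdd hm
      (unitMeasure_prod_ae_mem_Icc.mono fun z hz => hN z hz)).congr ?_
    filter_upwards [unitMeasure_prod_ae_mem] with z hz using (key z hz).symm
  rw [olssonIntegral, ← integral_congr_ae (unitMeasure_prod_ae_mem.mono key),
    ← integral_triangle hf hint]
  refine integral_congr_ae (unitMeasure_ae_mem.mono fun t ht => ?_)
  refine integral_congr_ae (unitMeasure_ae_mem.mono fun s hs => ?_)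
  have ht1 : 0 < 1 - t := sub_pos.2 ht.2
  have ht0 : ((1 - t : ℝ) : ℂ) ≠ 0 := ofReal_ne_zero.2 ht1.ne'
  have e1 : ((t + (1 - t) * s - t : ℝ) : ℂ) ^ (β - 1) =
      ((1 - t : ℝ) : ℂ) ^ (β - 1) * (s : ℂ) ^ (β - 1) := by
    rw [← mul_cpow_ofReal_nonneg ht1.le hs.1.le, ← ofReal_mul]
    congr 2
    ring
  have e2 : ((1 - (t + (1 - t) * s) : ℝ) : ℂ) ^ (δ - 1) =
      ((1 - t : ℝ) : ℂ) ^ (δ - 1) * ((1 - s : ℝ) : ℂ) ^ (δ - 1) := by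
    rw [← mul_cpow_ofReal_nonneg ht1.le (sub_nonneg.2 hs.2.le), ← ofReal_mul]
    congr 2
    ring
  have e3 : ((1 - t : ℝ) : ℂ) * (((1 - t : ℝ) : ℂ) ^ (β - 1) * ((1 - t : ℝ) : ℂ) ^ (δ - 1)) =
      ((1 - t : ℝ) : ℂ) ^ (β + δ - 1) := by
    nth_rewrite 1 [← cpow_one ((1 - t : ℝ) : ℂ)]
    rw [← cpow_add _ _ ht0, ← cpow_add _ _ ht0]
    congr 1
    ring
  have e4 : ((t + (1 - t) * s - t : ℝ) : ℂ) = (1 - t) * s := by push_cast; ring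
  have e5 (r : ℝ) : 1 - (r : ℂ) = ((1 - r : ℝ) : ℂ) := by push_cast; rfl
  simp only [f]
  rw [e1, e2, e4, betaW, betaW, e5, e5, ← e3]
  ring

/-! ### Growth of Pochhammer symbols -/

section PochhammerBound

lemma norm_poch_succ_ofReal {r : ℝ} (hr : 0 < r) (n : ℕ) :
    ‖poch r (n + 1)‖ = ‖poch r n‖ * (r + n) := by
  rw [poch_succ, norm_mul, ← ofReal_natCast, ← ofReal_add, norm_real,
    Real.norm_of_nonneg (by positivity)]

lemma poch_ofReal {r : ℝ} (hr : 0 < r) (n : ℕ) : poch r n = (‖poch r n‖ : ℝ) := by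
  induction n with
  | zero => simp [poch_zero]
  | succ n ih =>
    rw [norm_poch_succ_ofReal hr, poch_succ, ofReal_mul, ← ih]
    simp

/-- The ratio of consecutive quotients |(b)_n| / (r)_n is |b + n| / (r + n), which is at most 1 for
large n, so the quotients are eventually nonincreasing. -/
lemma exists_norm_poch_le {b : ℂ} {r : ℝ} (hr : 0 < r) (hb : b.re < r) :
    ∃ C : ℝ, ∀ n, ‖poch b n‖ ≤ C * ‖poch r n‖ := by
  obtain ⟨N, hN⟩ : ∃ N : ℕ, ∀ n ≥ N, ‖b + n‖ ≤ r + n := by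
    -- Squared, the inequality reads (Im b)² ≤ (r - Re b)(r + Re b + 2n), which gives this
    -- threshold.
    obtain ⟨N, hN⟩ := exists_nat_ge ((b.im ^ 2 / (r - b.re) - r - b.re) / 2)
    refine ⟨N, fun n hn => abs_le_of_sq_le_sq' ?_ (by positivity) |>.2⟩
    have hn' : (N : ℝ) ≤ n := by exact_mod_cast hn
    have hd : 0 < r - b.re := sub_pos.2 hb
    have h : b.im ^ 2 / (r - b.re) ≤ r + b.re + 2 * n := by linarith
    rw [div_le_iff₀ hd] at h
    rw [Complex.sq_norm, normSq_apply]
    simp only [add_re, natCast_re, add_im, natCast_im, add_zero]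
    nlinarith
  have hpos : ∀ n, 0 < ‖poch r n‖ := fun n => norm_pos_iff.2 (poch_ne_zero (by simpa using hr) n)
  -- The sum of the quotients up to N dominates each of them; it stands in for their maximum.
  refine ⟨∑ n ∈ Finset.range (N + 1), ‖poch b n‖ / ‖poch r n‖, fun n => ?_⟩
  have hle : ∀ n ≤ N, ‖poch b n‖ ≤
      (∑ n ∈ Finset.range (N + 1), ‖poch b n‖ / ‖poch r n‖) * ‖poch r n‖ := by
    intro n hn
    rw [← div_le_iff₀ (hpos n)]
    exact Finset.single_le_sum (f := fun n => ‖poch b n‖ / ‖poch r n‖)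
      (fun i _ => by positivity) (Finset.mem_range.2 (by omega))
  rcases le_total n N with hn | hn
  · exact hle n hn
  · induction n, hn using Nat.le_induction with
    | base => exact hle N le_rfl
    | succ n hn ih =>
      rw [norm_poch_succ_ofReal hr, poch_succ, norm_mul, ← mul_assoc]
      gcongr
      exact hN n hn

lemma hasSum_norm_binomial {r t : ℝ} (hr : 0 < r) (ht : t ∈ Ioo (0 : ℝ) 1) :
    HasSum (fun n : ℕ => ‖poch r n‖ / n.factorial * (1 - t) ^ n) (t ^ (-r)) := by
  have h := hasSum_binomial (r : ℂ) (z := ((1 - t : ℝ) : ℂ)) (by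
    rw [norm_real, Real.norm_of_nonneg (sub_pos.2 ht.2).le]
    linarith [ht.1])
  rw [← hasSum_ofReal]
  convert h using 1
  · ext n
    rw [poch_ofReal hr n]
    simp
  · rw [ofReal_cpow ht.1.le]
    simp

end PochhammerBound

/-! ### Dominated binomial expansion of the transformed integral -/

section Expansion

/-- 1 - ws is a convex combination of 1 and 1 - w. -/
lemma norm_one_sub_mul_le {w : ℂ} (hw : ‖1 - w‖ ≤ 1) {s : ℝ} (hs : s ∈ Ioo (0 : ℝ) 1) :
    ‖1 - w * s‖ ≤ 1 := by
  have e : 1 - w * s = ((1 - s : ℝ) : ℂ) + s * (1 - w) := by push_cast; ring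
  rw [e]
  refine (norm_add_le _ _).trans ?_
  rw [norm_mul, norm_real, norm_real, Real.norm_of_nonneg (sub_pos.2 hs.2).le,
    Real.norm_of_nonneg hs.1.le]
  nlinarith [hs.1]

/-- Re y > 1/2 says that y is closer to 1 than to 0. -/
lemma norm_one_sub_inv_lt {y : ℂ} (hy : 1 / 2 < y.re) : ‖1 - 1 / y‖ < 1 := by
  have hy0 : y ≠ 0 := by
    rintro rfl
    norm_num at hy
  rw [one_sub_div hy0, norm_div, div_lt_one (norm_pos_iff.2 hy0)]
  refine lt_of_pow_lt_pow_left₀ 2 (norm_nonneg _) ?_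
  rw [Complex.sq_norm, Complex.sq_norm, normSq_apply, normSq_apply]
  simp only [sub_re, one_re, sub_im, one_im, sub_zero]
  nlinarith

lemma integrable_betaW_mul_gaussKernel {a δ x : ℂ} (ha : 0 < a.re) (hδ : 0 < δ.re)
    (hx : x ∈ gaussDomain) (b : ℂ) :
    Integrable (fun t => betaW a δ t * (1 - x * t) ^ (-b)) unitMeasure := by
  have hc : ContinuousOn (fun t : ℝ => (1 - x * t) ^ (-b)) (Icc 0 1) :=
    continuousOn_one_sub_mul_cpow continuousOn_const (by fun_prop) _ fun t ht =>
      one_sub_mul_mem_slitPlane (mem_gaussDomain.1 hx) ht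
  obtain ⟨N, hN⟩ := isCompact_Icc.exists_bound_of_continuousOn hc
  refine (integrable_betaW ha hδ).mul_bdd (c := N) ?_ (unitMeasure_ae_mem_Icc.mono hN)
  exact Measurable.aestronglyMeasurable (by fun_prop)

lemma measurable_betaW (p q : ℂ) : Measurable (betaW p q) := by
  unfold betaW
  fun_prop

/-- Expansion of a double integral by the binomial series for
`(1 - (1 - t) (1 - w s)) ^ (-b₂)`. -/
lemma hasSum_integral_binomial {a β γ δ b₁ b₂ w x : ℂ} (ha : 0 < a.re) (hab : 0 < (a - b₂).re)
    (hβ : 0 < β.re) (hγ : 0 < γ.re) (hδ : 0 < δ.re) (hx : x ∈ gaussDomain) (hw : ‖1 - w‖ ≤ 1) :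
    Integrable (fun z : ℝ × ℝ => betaW a γ z.1 * (1 - x * z.1) ^ (-b₁) * betaW β δ z.2 *
      (1 - (1 - z.1) * (1 - w * z.2)) ^ (-b₂)) (unitMeasure.prod unitMeasure) ∧
    HasSum (fun i : ℕ => poch b₂ i / i.factorial *
        ((∫ t, betaW a (γ + i) t * (1 - x * t) ^ (-b₁) ∂unitMeasure) *
          ∫ s, betaW β δ s * (1 - w * s) ^ i ∂unitMeasure))
      (∫ z : ℝ × ℝ, betaW a γ z.1 * (1 - x * z.1) ^ (-b₁) * betaW β δ z.2 *
        (1 - (1 - z.1) * (1 - w * z.2)) ^ (-b₂) ∂(unitMeasure.prod unitMeasure)) := by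
  -- r > Re b₂ and r > 0 bound (b₂)_i by a multiple of (r)_i; r < Re a keeps t^(a-1) t^(-r)
  -- integrable at 0.
  obtain ⟨r, hr, hra⟩ : ∃ r : ℝ, max b₂.re 0 < r ∧ r < a.re :=
    exists_between (max_lt (by simpa using hab) ha)
  obtain ⟨hrb, hr0⟩ := max_lt_iff.1 hr
  obtain ⟨C, hC⟩ := exists_norm_poch_le hr0 hrb
  have hmβ := measurable_betaW β δ
  have hmγ := measurable_betaW a γ
  let W : ℝ × ℝ → ℂ := fun z => betaW a γ z.1 * (1 - x * z.1) ^ (-b₁) * betaW β δ z.2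
  have hWm : Measurable W := by
    simp only [W]
    fun_prop
  let bound : ℕ → ℝ × ℝ → ℝ := fun i z =>
    C * ‖W z‖ * (‖poch r i‖ / i.factorial * (1 - z.1) ^ i)
  have hbs : ∀ᵐ z ∂(unitMeasure.prod unitMeasure),
      HasSum (fun i => bound i z) (C * ‖W z‖ * z.1 ^ (-r)) := by
    filter_upwards [unitMeasure_prod_ae_mem] with z hz
    exact (hasSum_norm_binomial hr0 hz.1).mul_left _
  have hbi : Integrable (fun z => C * ‖W z‖ * z.1 ^ (-r)) (unitMeasure.prod unitMeasure) := by
    -- The summed bound t^(-r) only shifts the first beta parameter from a to a - r.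
    have h := ((integrable_betaW_mul_gaussKernel (a := a - r) (by simpa using hra) hγ hx
      b₁).mul_prod (integrable_betaW hβ hδ)).norm.const_mul C
    refine h.congr ?_
    filter_upwards [unitMeasure_prod_ae_mem] with z hz
    have hz0 : (z.1 : ℂ) ≠ 0 := ofReal_ne_zero.2 hz.1.1.ne'
    have e : betaW (a - r) γ z.1 = betaW a γ z.1 * (z.1 : ℂ) ^ (-(r : ℂ)) := by
      rw [betaW, betaW, show a - r - 1 = a - 1 + -r by ring, cpow_add _ _ hz0]
      ring
    have e2 : ‖(z.1 : ℂ) ^ (-(r : ℂ))‖ = z.1 ^ (-r) := by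
      rw [norm_cpow_eq_rpow_re_of_pos hz.1.1]
      simp
    simp only [W, e, norm_mul, e2]
    ring
  let F : ℕ → ℝ × ℝ → ℂ := fun i z =>
    W z * (poch b₂ i / i.factorial * ((1 - z.1) * (1 - w * z.2)) ^ i)
  have hFb : ∀ i, ∀ z ∈ Ioo (0 : ℝ) 1 ×ˢ Ioo (0 : ℝ) 1, ‖F i z‖ ≤ bound i z := by
    intro i z hz
    have h1 := norm_one_sub_mul_le hw hz.2
    have ht : (0 : ℝ) ≤ 1 - z.1 := (sub_pos.2 hz.1.2).le
    have e : ‖(1 - (z.1 : ℂ))‖ = 1 - z.1 := by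
      rw [← ofReal_one, ← ofReal_sub, norm_real, Real.norm_of_nonneg ht]
    simp only [F, bound]
    rw [norm_mul (W z), norm_mul (poch b₂ i / _), norm_pow, norm_mul (1 - (z.1 : ℂ)), norm_div, e,
      mul_pow, norm_natCast]
    calc ‖W z‖ * (‖poch b₂ i‖ / i.factorial * ((1 - z.1) ^ i * ‖1 - w * z.2‖ ^ i))
        ≤ ‖W z‖ * ((C * ‖poch r i‖) / i.factorial * ((1 - z.1) ^ i * 1)) := by
          have := pow_le_one₀ (n := i) (norm_nonneg _) h1
          have := hC i
          have : 0 ≤ C * ‖poch r i‖ := (norm_nonneg _).trans this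
          gcongr
      _ = _ := by ring
  have hlim : ∀ z ∈ Ioo (0 : ℝ) 1 ×ˢ Ioo (0 : ℝ) 1,
      HasSum (fun i => F i z) (W z * (1 - (1 - z.1) * (1 - w * z.2)) ^ (-b₂)) := by
    intro z hz
    refine (hasSum_binomial b₂ ?_).mul_left _
    have h1 := norm_one_sub_mul_le hw hz.2
    have ht : (0 : ℝ) ≤ 1 - z.1 := (sub_pos.2 hz.1.2).le
    rw [norm_mul, ← ofReal_one, ← ofReal_sub, norm_real, Real.norm_of_nonneg ht, ofReal_one]
    refine (mul_le_of_le_one_right ht h1).trans_lt ?_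
    linarith [hz.1.1]
  constructor
  · refine hbi.mono' (Measurable.aestronglyMeasurable (by fun_prop)) ?_
    filter_upwards [unitMeasure_prod_ae_mem, hbs] with z hz hbz
    have := tsum_of_norm_bounded hbz fun i => hFb i z hz
    rwa [(hlim z hz).tsum_eq] at this
  · have h := hasSum_integral_of_dominated_convergence (μ := unitMeasure.prod unitMeasure)
      (F := F) bound
      (fun i => Measurable.aestronglyMeasurable (by simp only [F]; fun_prop))
      (fun i => unitMeasure_prod_ae_mem.mono (hFb i)) (hbs.mono fun z hz => hz.summable)
      (hbi.congr (hbs.mono fun z hz => hz.tsum_eq.symm)) (unitMeasure_prod_ae_mem.mono hlim)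
    convert! h using 1
    ext i
    rw [← integral_prod_mul, ← integral_const_mul]
    refine integral_congr_ae (unitMeasure_prod_ae_mem.mono fun z hz => ?_)
    simp only [F, W]
    -- The factor (1 - t)^i is absorbed into the beta weight, which turns γ into γ + i.
    rw [← betaW_mul_one_sub_pow _ _ hz.1, mul_pow]
    ring

end Expansion

/-! ### Identification of the terms and conclusion -/

lemma almstromOlssonTerm_eq {a b₁ b₂ c₁ c₂ x y : ℂ} (ha : 0 < a.re)
    (hγ : 0 < (b₂ + c₁ - a).re) (hβ : 0 < (b₂ - c₂ + 1).re) (hδ : 0 < (c₁ + c₂ - a - 1).re)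
    (hx : x ∈ gaussDomain) (i : ℕ) :
    almstromOlssonTerm a b₁ b₂ c₁ c₂ x y i =
      (betaIntegral a (b₂ + c₁ - a) * betaIntegral (b₂ - c₂ + 1) (c₁ + c₂ - a - 1))⁻¹ *
      (poch b₂ i / i.factorial *
        ((∫ t, betaW a (b₂ + c₁ - a + i) t * (1 - x * t) ^ (-b₁) ∂unitMeasure) *
          ∫ s, betaW (b₂ - c₂ + 1) (c₁ + c₂ - a - 1) s * (1 - 1 / y * s) ^ i ∂unitMeasure)) := by
  have hγi : 0 < (b₂ + c₁ - a + i).re := by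
    rw [add_re, natCast_re]
    positivity
  have hs : 0 < (a + (b₂ + c₁ - a)).re := by
    rw [add_re]
    positivity
  have h1 := gaussF_eq_gaussIntegral (b := b₁) ha hγi hx
  have h2 := ordinaryHypergeometric_neg_natCast_eq_integral hβ hδ i (1 / y)
  -- B(a, γ + i) = (γ)_i/(a + γ)_i · B(a, γ), so the Pochhammer quotient in the term cancels the
  -- dependence of the normalization on i.
  have h3 := betaIntegral_add_natCast hγ ha i
  rw [betaIntegral_symm, betaIntegral_symm a, add_comm _ a] at h3
  rw [show a + (b₂ + c₁ - a + i) = b₂ + c₁ + i by ring] at h1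
  rw [show b₂ - c₂ + 1 + (c₁ + c₂ - a - 1) = b₂ + c₁ - a by ring] at h2
  have hB := betaIntegral_ne_zero ha hγ
  have hp1 := poch_ne_zero hγ i
  have hp2 := poch_ne_zero hs i
  rw [almstromOlssonTerm, h1, h2, gaussIntegral, h3]
  rw [show a + (b₂ + c₁ - a) = b₂ + c₁ by ring] at hp2 ⊢
  field_simp

/-- Both bases on the left have positive real part, the second because it lies within distance 1 of
1, so principal powers multiply. -/
lemma cpow_mul_expansionKernel {b y : ℂ} (hy : 1 / 2 < y.re) {t s : ℝ}
    (ht : t ∈ Ioo (0 : ℝ) 1) (hs : s ∈ Ioo (0 : ℝ) 1) :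
    y ^ b * (1 - (1 - t) * (1 - 1 / y * s)) ^ b = (t * y + (1 - t) * s) ^ b := by
  have hy0 : y ≠ 0 := by
    rintro rfl
    norm_num at hy
  have h1 := norm_one_sub_mul_le (norm_one_sub_inv_lt hy).le hs
  have ht1 : (0 : ℝ) ≤ 1 - t := (sub_pos.2 ht.2).le
  rw [← mul_cpow_of_re_pos (by linarith)]
  · congr 1
    field_simp
    ring
  · have h2 : ‖(1 - (t : ℂ)) * (1 - 1 / y * s)‖ < 1 := by
      rw [norm_mul, ← ofReal_one, ← ofReal_sub, norm_real, Real.norm_of_nonneg ht1, ofReal_one]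
      refine (mul_le_of_le_one_right ht1 h1).trans_lt ?_
      linarith [ht.1]
    have h3 := (re_le_norm _).trans_lt h2
    rw [sub_re, one_re]
    linarith

end Olsson

theorem mainTheorem7 (a b₁ b₂ c₁ c₂ : ℂ)
    (h₁ : 0 < a.re) (h₂ : 0 < (a - b₂).re) (h₃ : 0 < (b₂ + c₁ - a).re)
    (h₄ : 0 < (b₂ - c₂ + 1).re) (h₅ : 0 < (c₁ + c₂ - a - 1).re) :
    -- the analytic continuations that occur in the formula exist
    IsHolomorphicContinuation (olssonSeries a b₁ b₂ c₁ c₂) olssonPolydisc olssonDomain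
      (olssonFP a b₁ b₂ c₁ c₂) ∧
    (∀ i : ℕ, IsHolomorphicContinuation
      (ordinaryHypergeometric a b₁ (b₂ + c₁ + i) : ℂ → ℂ) (Metric.ball 0 1) gaussDomain
      (gaussF a b₁ (b₂ + c₁ + i))) ∧
    -- the expansion
    ∀ x y : ℂ, (x, y) ∈ olssonDomain → 1 / 2 < y.re →
      Summable (almstromOlssonTerm a b₁ b₂ c₁ c₂ x y) ∧
      olssonFP a b₁ b₂ c₁ c₂ (x, y) =
        Complex.Gamma c₁ * Complex.Gamma (a + b₂ - c₂ + 1) /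
            (Complex.Gamma (a - c₂ + 1) * Complex.Gamma (b₂ + c₁)) * y ^ (-b₂) *
          ∑' i : ℕ, almstromOlssonTerm a b₁ b₂ c₁ c₂ x y i := by
  have hp : 0 < (a - c₂ + 1).re := by
    -- p = (a - b₂) + β, a sum of two quantities with positive real part.
    have := add_pos h₂ h₄
    rwa [← Complex.add_re, show a - b₂ + (b₂ - c₂ + 1) = a - c₂ + 1 by ring] at this
  have hcont := Olsson.isHolomorphicContinuation_olssonIntegral (b₁ := b₁) h₁ h₄ hp h₅
  refine ⟨Olsson.isHolomorphicContinuation_holomorphicContinuation hcont, fun i => ?_,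
    fun x y hxy hy => ?_⟩
  · have hi : 0 < (b₂ + c₁ - a + i).re := by
      rw [Complex.add_re, Complex.natCast_re]
      positivity
    have h := Olsson.isHolomorphicContinuation_gaussIntegral (b := b₁) h₁ hi
    rw [show a + (b₂ + c₁ - a + i) = b₂ + c₁ + i by ring] at h
    exact Olsson.isHolomorphicContinuation_holomorphicContinuation h
  have hx : x ∈ gaussDomain := hxy.1
  obtain ⟨hint, hsum⟩ := Olsson.hasSum_integral_binomial (b₁ := b₁) h₁ h₂ h₄ h₃ h₅ hx
    (Olsson.norm_one_sub_inv_lt hy).le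
  have hterm := hsum.mul_left (Complex.betaIntegral a (b₂ + c₁ - a) *
    Complex.betaIntegral (b₂ - c₂ + 1) (c₁ + c₂ - a - 1))⁻¹
  simp_rw [← Olsson.almstromOlssonTerm_eq h₁ h₃ h₄ h₅ hx] at hterm
  refine ⟨hterm.summable, ?_⟩
  have hFP : olssonFP a b₁ b₂ c₁ c₂ (x, y) = _ :=
    Olsson.holomorphicContinuation_eqOn Olsson.isOpen_olssonDomain Olsson.starConvex_olssonDomain
      Olsson.olssonDomain_zero_one_mem Olsson.olssonPolydisc_mem_nhds hcont hxy
  have hchange := Olsson.integral_eq_olssonIntegral (b₁ := b₁) (b₂ := b₂) h₁ h₄ h₅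
    (by rwa [show a + (b₂ - c₂ + 1) - b₂ = a - c₂ + 1 by ring]) hxy
  rw [show b₂ - c₂ + 1 + (c₁ + c₂ - a - 1) = b₂ + c₁ - a by ring,
    show a + (b₂ - c₂ + 1) - b₂ = a - c₂ + 1 by ring] at hchange
  have hJ : y ^ (-b₂) * ∫ z : ℝ × ℝ, Olsson.betaW a (b₂ + c₁ - a) z.1 *
        (1 - x * z.1) ^ (-b₁) * Olsson.betaW (b₂ - c₂ + 1) (c₁ + c₂ - a - 1) z.2 *
        (1 - (1 - z.1) * (1 - 1 / y * z.2)) ^ (-b₂)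
          ∂(Olsson.unitMeasure.prod Olsson.unitMeasure) =
      Olsson.olssonIntegral a (b₂ - c₂ + 1) (a - c₂ + 1) (c₁ + c₂ - a - 1) b₁ b₂ (x, y) := by
    rw [← hchange, MeasureTheory.integral_prod _ hint, ← MeasureTheory.integral_const_mul]
    refine MeasureTheory.integral_congr_ae (Olsson.unitMeasure_ae_mem.mono fun t ht => ?_)
    beta_reduce
    rw [← MeasureTheory.integral_const_mul]
    refine MeasureTheory.integral_congr_ae (Olsson.unitMeasure_ae_mem.mono fun s hs => ?_)
    beta_reduce
    rw [← Olsson.cpow_mul_expansionKernel hy ht hs]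
    ring
  rw [hFP, hterm.tsum_eq, ← hJ]
  have hs₁ : 0 < (b₂ + c₁).re := by
    have := add_pos h₁ h₃
    rwa [← Complex.add_re, add_sub_cancel] at this
  have hs₂ : 0 < (a + b₂ - c₂ + 1).re := by
    have := add_pos h₁ h₄
    rwa [← Complex.add_re, show a + (b₂ - c₂ + 1) = a + b₂ - c₂ + 1 by ring] at this
  have hs₃ : 0 < c₁.re := by
    have := add_pos hp h₅
    rwa [← Complex.add_re, show a - c₂ + 1 + (c₁ + c₂ - a - 1) = c₁ by ring] at this
  rw [Complex.betaIntegral_eq_Gamma_mul_div _ _ h₁ h₄,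
    Complex.betaIntegral_eq_Gamma_mul_div _ _ hp h₅,
    Complex.betaIntegral_eq_Gamma_mul_div _ _ h₁ h₃,
    Complex.betaIntegral_eq_Gamma_mul_div _ _ h₄ h₅,
    show a - c₂ + 1 + (c₁ + c₂ - a - 1) = c₁ by ring,
    show a + (b₂ - c₂ + 1) = a + b₂ - c₂ + 1 by ring,
    show b₂ - c₂ + 1 + (c₁ + c₂ - a - 1) = b₂ + c₁ - a by ring,
    show a + (b₂ + c₁ - a) = b₂ + c₁ by ring]
  have g₁ := Complex.Gamma_ne_zero_of_re_pos h₁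
  have g₂ := Complex.Gamma_ne_zero_of_re_pos h₃
  have g₃ := Complex.Gamma_ne_zero_of_re_pos h₄
  have g₄ := Complex.Gamma_ne_zero_of_re_pos h₅
  have g₅ := Complex.Gamma_ne_zero_of_re_pos hp
  have g₆ := Complex.Gamma_ne_zero_of_re_pos hs₁
  have g₇ := Complex.Gamma_ne_zero_of_re_pos hs₂
  have g₈ := Complex.Gamma_ne_zero_of_re_pos hs₃
  -- Since γ = β + δ, this value is a numerator in B(a, γ) and the denominator in B(β, δ), and it
  -- cancels from their product.
  generalize Complex.Gamma (b₂ + c₁ - a) = G at *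
  field_simp
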